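/- **Geometric logic.** Let $\mathrm{At}$ be a set. Conjunctive formulae over $\mathrm{At}$ are generated by $\gamma ::= p \mid \mathrm{true} \mid \gamma\wedge\gamma$ ($p\in\mathrm{At}$). A geometric formula is a disjunction $\bigvee S$ of a set $S$ of conjunctive formulae; $\mathrm{Geom}(\mathrm{At})$ is the set of these. Put $\mathrm{false}=\bigvee\emptyset$, let $\bigvee_i\varphi_i$ be the disjunction of all disjuncts of the $\varphi_i$, and let $\varphi\wedge\psi$ be the disjunction of all $\gamma\wedge\gamma'$ with $\gamma$ a disjunct of $\varphi$ and $\gamma'$ one of $\psi$. A geometric theory $T$ over $\mathrm{At}$ is a set of sequents $\psi\vdash\varphi$ with $\psi,\varphi\in\mathrm{Geom}(\mathrm{At})$. The deduction relation $\vdash_T$ is the least reflexive and transitive relation on $\mathrm{Geom}(\mathrm{At})$ containing $T$ such that $\varphi\wedge\psi\vdash_T\varphi$; $\varphi\wedge\psi\vdash_T\psi$; $\theta\vdash_T\varphi\wedge\psi$ whenever $\theta\vdash_T\varphi$ and $\theta\vdash_T\psi$; $\varphi\vdash_T\mathrm{true}$; $\varphi_i\vdash_T\bigvee_i\varphi_i$;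 and $\bigvee_i\varphi_i\vdash_T\psi$ whenever $\varphi_i\vdash_T\psi$ for all $i$. The quotient $\mathrm{Geom}(\mathrm{At})/T$ of this preorder by mutual derivability is a frame. A frame $L$ is spatial if for all $a\not\le b$ in $L$ there is a point of $L$ (a completely prime filter) containing $a$ but not $b$. $\mathrm{Mod}(T)$ is the set of valuations $\nu:\mathrm{At}\to\{0,1\}$ such that $\nu\models\psi$ implies $\nu\models\varphi$ for each $(\psi\vdash\varphi)\in T$. Deduction over $T$ is complete if for all $\psi,\varphi$: $\psi\vdash_T\varphi$ if and only if every $\nu\in\mathrm{Mod}(T)$ with $\nu\models\psi$ satisfies $\nu\models\varphi$. **Streams and LTL.** Let $B$ be a set and let $[\![\mathrm{Stream}\,B]\!]$ be the set of functions from $\mathbb N$ to the flat cpo $B\cup\{\bot\}$, ordered pointwise; $\mathrm{Fin}([\![\mathrm{Stream}\,B]\!])$ is the set of its finite (compact) elements. The class $G$ of LTL formulae is given by $\Phi ::= a \mid \mathrm{True}\mid\mathrm{False}\mid\Phi\wedge\Phi\mid\Phi\vee\Phi\mid\bigcirc\Phi\mid\Phi\,\mathsf U\,\Phi$ ($a\in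 B$), and the class $G_\delta$ by $\Phi::=\Phi_1\mid\Phi\wedge\Phi\mid\Phi\vee\Phi\mid\bigcirc\Phi\mid\Phi\,\mathsf W\,\Phi$ with $\Phi_1\in G$, where $\mathsf U$ is until and $\mathsf W$ is weak until. For a geometric formula $\varphi$ over $\mathrm{Fin}([\![\mathrm{Stream}\,B]\!])$, $\bigcirc\varphi$ is obtained by replacing each atom $d$ by $\bot\cdot d$. For $\Phi\in G$ the geometric formula $F[\![\Phi]\!]$ is defined by $F[\![a]\!]=a\cdot\bot^\omega$, by commutation with $\mathrm{True},\mathrm{False},\wedge,\vee,\bigcirc$, and by $F[\![\Phi\,\mathsf U\,\Psi]\!]=\bigvee_{n\in\mathbb N}h^n(\mathrm{false})$ with $h(\theta)=F[\![\Psi]\!]\vee(F[\![\Phi]\!]\wedge\bigcirc\theta)$. For $\Phi\in G_\delta$ the geometric theory $T[\![\Phi]\!]$ over $\mathrm{Fin}([\![\mathrm{Stream}\,B]\!])$, all of whose sequents have the form $\vdash\varphi$ (meaning $\mathrm{true}\vdash\varphi$), is defined as follows: $T[\![\Phi]\!]=\{\vdash F[\![\Phi]\!]\}$ if $\Phi\in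 G$; for formulae not in $G$, $T[\![\Phi\wedge\Psi]\!]=T[\![\Phi]\!]\cup T[\![\Psi]\!]$, $T[\![\Phi\vee\Psi]\!]=T[\![\Phi]\!]\curlyvee T[\![\Psi]\!]$ where $A\curlyvee A'=\{\vdash\varphi\vee\varphi'\mid(\vdash\varphi)\in A,(\vdash\varphi')\in A'\}$, and $T[\![\bigcirc\Phi]\!]=\{\vdash\bigcirc\varphi\mid(\vdash\varphi)\in T[\![\Phi]\!]\}$; finally $T[\![\Phi\,\mathsf W\,\Psi]\!]=\{\vdash h^n(\mathrm{true})\mid n\in\mathbb N\}$ if $\Phi,\Psi\in G$ (with $h$ as above), and otherwise $T[\![\Phi\,\mathsf W\,\Psi]\!]=\bigcup_{n\in\mathbb N}H^n(\{\vdash\mathrm{true}\})$ with $H(C)=T[\![\Psi]\!]\curlyvee(T[\![\Phi]\!]\cup\bigcirc C)$, where $\bigcirc C=\{\vdash\bigcirc\varphi\mid(\vdash\varphi)\in C\}$. **Statement.** (1) Let $T$ be a geometric theory over a set $\mathrm{At}$. If $T$ is (at most) countable, then the frame $\mathrm{Geom}(\mathrm{At})/T$ is spatial, and deduction over $T$ is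 complete. (2) In particular, for every set $B$ and every $G_\delta$ formula $\Phi$ of $\mathrm{LTL}(B)$, the frame $\mathrm{Geom}(\mathrm{Fin}([\![\mathrm{Stream}\,B]\!]))/T[\![\Phi]\!]$ is spatial, and deduction over $T[\![\Phi]\!]$ is complete. -/

import Mathlib

/-! # Geometric propositional logic, its deduction system and its models -/

namespace StreamLogic

universe u

/-- Conjunctive formulae over a set `At` of atomic propositions. -/
inductive Conj (At : Type u) : Type u
  | atom (p : At) : Conj At
  | tru : Conj At
  | and (γ γ' : Conj At) : Conj At

/-- Geometric formulae over `At`: (possibly infinite) disjunctions `⋁ S` of a set `S` of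
conjunctive formulae. -/
structure Geom (At : Type u) : Type u where
  /-- the formula `⋁ S` -/
  disj ::
  /-- the set of disjuncts of a geometric formula -/
  disjuncts : Set (Conj At)

/-- A sequent `ψ ⊢ φ`. -/
structure Sequent (At : Type u) : Type u where
  lhs : Geom At
  rhs : Geom At

/-- A geometric theory over `At` is a set of sequents. -/
abbrev Theory (At : Type u) : Type u := Set (Sequent At)

namespace Geom

variable {At : Type u}

/-- A conjunctive formula `γ` seen as the geometric formula `⋁ {γ}`. -/
def ofConj (γ : Conj At) : Geom At := disj {γ}

/-- The formula `true`. -/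
def tru : Geom At := ofConj Conj.tru

/-- The formula `false`, i.e. `⋁ ∅`. -/
def fls : Geom At := disj ∅

/-- `⋁ᵢ φᵢ`: the disjunction of all disjuncts of the `φᵢ`. -/
def iOr {ι : Type*} (φ : ι → Geom At) : Geom At := disj (⋃ i, (φ i).disjuncts)

/-- `φ ∨ ψ`. -/
def or (φ ψ : Geom At) : Geom At := disj (φ.disjuncts ∪ ψ.disjuncts)

/-- `φ ∧ ψ := ⋁ { γ ∧ γ' | γ a disjunct of φ, γ' a disjunct of ψ }`. -/
def and (φ ψ : Geom At) : Geom At := disj (Set.image2 Conj.and φ.disjuncts ψ.disjuncts)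

end Geom

/-- `ν ⊨ γ` for a valuation `ν` and a conjunctive formula `γ`. -/
def Conj.Sat {At : Type u} (ν : At → Prop) : Conj At → Prop
  | .atom p => ν p
  | .tru => True
  | .and γ γ' => γ.Sat ν ∧ γ'.Sat ν

/-- `ν ⊨ φ` for a valuation `ν` and a geometric formula `φ`. -/
def Geom.Sat {At : Type u} (ν : At → Prop) (φ : Geom At) : Prop :=
  ∃ γ ∈ φ.disjuncts, γ.Sat ν

/-- `Mod(T)`: the valuations `ν` such that `ν ⊨ ψ` implies `ν ⊨ φ` for each sequent `ψ ⊢ φ`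
of `T`. -/
def Mod {At : Type u} (T : Theory At) : Set (At → Prop) :=
  {ν | ∀ s ∈ T, s.lhs.Sat ν → s.rhs.Sat ν}

/-- The preorder `ψ ≼_M φ`: each valuation in `M` satisfying `ψ` satisfies `φ`. -/
def Entails {At : Type u} (M : Set (At → Prop)) (ψ φ : Geom At) : Prop :=
  ∀ ν ∈ M, ψ.Sat ν → φ.Sat ν

/-- The deduction relation `φ ⊢_T ψ` of geometric logic over the theory `T`. -/
inductive Deriv {At : Type u} (T : Theory At) : Geom At → Geom At → Prop
  | th {φ ψ : Geom At} : Sequent.mk φ ψ ∈ T → Deriv T φ ψ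
  | ax (φ : Geom At) : Deriv T φ φ
  | cut {φ θ ψ : Geom At} : Deriv T φ θ → Deriv T θ ψ → Deriv T φ ψ
  | andL₁ (φ ψ : Geom At) : Deriv T (φ.and ψ) φ
  | andL₂ (φ ψ : Geom At) : Deriv T (φ.and ψ) ψ
  | andR {θ φ ψ : Geom At} : Deriv T θ φ → Deriv T θ ψ → Deriv T θ (φ.and ψ)
  | truR (φ : Geom At) : Deriv T φ Geom.tru
  | orL {ι : Type u} {φ : ι → Geom At} {ψ : Geom At} :
      (∀ i, Deriv T (φ i) ψ) → Deriv T (Geom.iOr φ) ψ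
  | orR {ι : Type u} (φ : ι → Geom At) (i : ι) : Deriv T (φ i) (Geom.iOr φ)

/-- `T`-equivalence: `φ ⊢_T ψ` and `ψ ⊢_T φ`. -/
def theorySetoid {At : Type u} (T : Theory At) : Setoid (Geom At) where
  r φ ψ := Deriv T φ ψ ∧ Deriv T ψ φ
  iseqv :=
    ⟨fun φ => ⟨.ax φ, .ax φ⟩, fun h => ⟨h.2, h.1⟩, fun h k => ⟨h.1.cut k.1, k.2.cut h.2⟩⟩

/-- The set `Geom(At)/T` of `T`-equivalence classes of geometric formulae. -/
def GeomQuot {At : Type u} (T : Theory At) : Type u := Quotient (theorySetoid T)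

namespace GeomQuot

variable {At : Type u} {T : Theory At}

/-- The class `[φ]_T`. -/
def mk (T : Theory At) (φ : Geom At) : GeomQuot T := Quotient.mk (theorySetoid T) φ

/-- The order `≤_T`: `[φ]_T ≤ [ψ]_T` iff `φ ⊢_T ψ`. -/
instance : PartialOrder (GeomQuot T) where
  le := Quotient.lift₂ (Deriv T) (fun _ _ _ _ h k =>
    propext ⟨fun d => (h.2.cut d).cut k.1, fun d => (h.1.cut d).cut k.2⟩)
  le_refl := by rintro ⟨φ⟩; exact Deriv.ax φ
  le_trans := by rintro ⟨φ⟩ ⟨ψ⟩ ⟨θ⟩ h k; exact Deriv.cut h k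
  le_antisymm := by rintro ⟨φ⟩ ⟨ψ⟩ h k; exact Quotient.sound ⟨h, k⟩

theorem mk_le_mk {φ ψ : Geom At} : mk T φ ≤ mk T ψ ↔ Deriv T φ ψ := Iff.rfl

theorem mk_surjective : Function.Surjective (mk T) := Quotient.exists_rep

instance : SupSet (GeomQuot T) where
  sSup s := mk T (Geom.iOr (fun φ : {φ : Geom At // mk T φ ∈ s} => φ.1))

theorem isLUB_sSup (s : Set (GeomQuot T)) : IsLUB s (sSup s) := by
  constructor
  · intro a ha
    obtain ⟨φ, rfl⟩ := mk_surjective a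
    exact Deriv.orR (fun φ : {φ : Geom At // mk T φ ∈ s} => φ.1) ⟨φ, ha⟩
  · intro b hb
    obtain ⟨ψ, rfl⟩ := mk_surjective b
    exact Deriv.orL (fun i => hb i.2)

theorem isGLB_mk_and (φ ψ : Geom At) : IsGLB {mk T φ, mk T ψ} (mk T (φ.and ψ)) := by
  constructor
  · rintro a (rfl | rfl)
    · exact Deriv.andL₁ φ ψ
    · exact Deriv.andL₂ φ ψ
  · intro b hb
    obtain ⟨θ, rfl⟩ := mk_surjective b
    exact Deriv.andR (hb (Or.inl rfl)) (hb (Or.inr rfl))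

noncomputable instance : CompleteLattice (GeomQuot T) :=
  completeLatticeOfSup (GeomQuot T) isLUB_sSup

theorem mk_inf_mk (φ ψ : Geom At) : mk T φ ⊓ mk T ψ = mk T (φ.and ψ) :=
  isGLB_pair.unique (isGLB_mk_and φ ψ)

/-- `Geom(At)/T` is a frame. -/
noncomputable instance : Order.Frame (GeomQuot T) :=
  Order.Frame.ofMinimalAxioms
    { inf_sSup_le_iSup_inf := by
        intro a s
        obtain ⟨ψ, rfl⟩ := mk_surjective a
        change mk T ψ ⊓ mk T _ ≤ _
        rw [mk_inf_mk]
        have key : ψ.and (Geom.iOr (fun φ : {φ : Geom At // mk T φ ∈ s} => φ.1)) =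
            Geom.iOr (fun φ : {φ : Geom At // mk T φ ∈ s} => ψ.and φ.1) := by
          simp [Geom.and, Geom.iOr, Set.image2_iUnion_right]
        rw [key]
        obtain ⟨χ, hχ⟩ := mk_surjective (⨆ b ∈ s, mk T ψ ⊓ b)
        rw [← hχ]
        refine Deriv.orL (fun i => ?_)
        rw [← mk_le_mk, hχ, ← mk_inf_mk]
        exact le_iSup₂_of_le (mk T i.1) i.2 le_rfl }

end GeomQuot

/-- A frame `L` is spatial when, for all `a ≰ b` in `L`, there is a point of `L` (a frame morphism
from `L` to the two-element frame, i.e. a completely prime filter of `L`) which contains `a`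
but not `b`. -/
def IsSpatial (L : Type u) [Order.Frame L] : Prop :=
  ∀ a b : L, ¬ a ≤ b → ∃ x : Locale.PT L, x a ∧ ¬ x b

/-- Deduction over `T` is complete: `ψ ⊢_T φ` if and only if each model of `T` satisfying `ψ`
satisfies `φ`. -/
def DeductionComplete {At : Type u} (T : Theory At) : Prop :=
  ∀ ψ φ : Geom At, Deriv T ψ φ ↔ Entails (Mod T) ψ φ

/-! # The domain of streams -/

/-- The domain `⟦Stream B⟧` of streams over `B`: sequences of elements of the flat cpo `B ∪ {⊥}`
(Mathlib's `Part B`, with `⊥ = Part.none`), with the pointwise order. -/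
abbrev StreamDom (B : Type u) : Type u := ℕ → Part B

/-- `x · σ`: the stream with head `x` and tail `σ`. -/
def StreamDom.cons {B : Type u} (x : Part B) (σ : StreamDom B) : StreamDom B
  | 0 => x
  | n + 1 => σ n

/-- `Fin(⟦Stream B⟧)`: the finite (i.e. compact) elements of the domain of streams. -/
abbrev FinStream (B : Type u) : Type u := {d : StreamDom B // IsCompactElement d}

namespace FinStream

variable {B : Type u}

theorem isCompactElement_bot : IsCompactElement (⊥ : StreamDom B) := by
  rintro s u ⟨x, hx⟩ - - -
  exact ⟨x, hx, bot_le⟩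

theorem isCompactElement_cons (x : Part B) {d : StreamDom B} (hd : IsCompactElement d) :
    IsCompactElement (StreamDom.cons x d) := by
  intro s u hne hdir hlub hle
  have hproj := isLUB_pi.1 hlub
  -- the tail
  obtain ⟨_, ⟨y, hy, rfl⟩, hdy⟩ := hd ((fun σ n => σ (n + 1)) '' s) (fun n => u (n + 1))
    (hne.image _)
    (by
      rintro _ ⟨σ, hσ, rfl⟩ _ ⟨τ, hτ, rfl⟩
      obtain ⟨ρ, hρ, h₁, h₂⟩ := hdir σ hσ τ hτ
      exact ⟨_, ⟨ρ, hρ, rfl⟩, fun n => h₁ (n + 1), fun n => h₂ (n + 1)⟩)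
    (by
      refine isLUB_pi.2 (fun n => ?_)
      rw [← Set.image_comp]
      exact hproj (n + 1))
    (fun n => hle (n + 1))
  -- the head
  have hx : ∃ z ∈ s, x ≤ z 0 := by
    rcases Part.eq_none_or_eq_some x with rfl | ⟨a, rfl⟩
    · exact ⟨y, hy, bot_le⟩
    · by_contra hcon
      push Not at hcon
      have hub : (Part.none : Part B) ∈ upperBounds (Function.eval 0 '' s) := by
        rintro _ ⟨z, hz, rfl⟩ b hb
        have hab : b = a := Part.mem_unique ((hproj 0).1 ⟨z, hz, rfl⟩ b hb)
          (hle 0 a (Part.mem_some a))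
        subst hab
        refine absurd (fun c hc => ?_) (hcon z hz)
        rw [Part.mem_some_iff.1 hc]
        exact hb
      exact Part.notMem_none a ((hproj 0).2 hub a (hle 0 a (Part.mem_some a)))
  obtain ⟨z, hz, hxz⟩ := hx
  obtain ⟨w, hw, hyw, hzw⟩ := hdir y hy z hz
  refine ⟨w, hw, fun n => ?_⟩
  cases n with
  | zero => exact hxz.trans (hzw 0)
  | succ n => exact (hdy n).trans (hyw (n + 1))

/-- The finite stream `a · ⊥^ω`. -/
def single (a : B) : FinStream B :=
  ⟨StreamDom.cons (Part.some a) ⊥, isCompactElement_cons _ isCompactElement_bot⟩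

/-- The finite stream `⊥ · d`. -/
def shift (d : FinStream B) : FinStream B :=
  ⟨StreamDom.cons ⊥ d.1, isCompactElement_cons _ d.2⟩

end FinStream

/-! # Linear temporal logic and its translation to geometric logic -/

/-- Formulae of `LTL(B)`. -/
inductive LTL (B : Type u) : Type u
  | atom (a : B) : LTL B
  | tru : LTL B
  | fls : LTL B
  | and (Φ Ψ : LTL B) : LTL B
  | or (Φ Ψ : LTL B) : LTL B
  | neg (Φ : LTL B) : LTL B
  | next (Φ : LTL B) : LTL B
  /-- (strong) until `Φ U Ψ` -/
  | til (Φ Ψ : LTL B) : LTL B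
  /-- weak until `Φ W Ψ` -/
  | wtil (Φ Ψ : LTL B) : LTL B

namespace LTL

variable {B : Type u}

/-- The class `G` of formulae: `Φ ::= a | True | False | Φ ∧ Φ | Φ ∨ Φ | ○Φ | Φ U Φ`. -/
def IsG : LTL B → Prop
  | atom _ => True
  | tru => True
  | fls => True
  | and Φ Ψ => Φ.IsG ∧ Ψ.IsG
  | or Φ Ψ => Φ.IsG ∧ Ψ.IsG
  | neg _ => False
  | next Φ => Φ.IsG
  | til Φ Ψ => Φ.IsG ∧ Ψ.IsG
  | wtil _ _ => False

/-- The class `G_δ` of formulae: `Φ ::= Φ₁ | Φ ∧ Φ | Φ ∨ Φ | ○Φ | Φ W Φ` with `Φ₁` in `G`. -/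
inductive IsGδ : LTL B → Prop
  | ofG {Φ : LTL B} : Φ.IsG → IsGδ Φ
  | and {Φ Ψ : LTL B} : IsGδ Φ → IsGδ Ψ → IsGδ (and Φ Ψ)
  | or {Φ Ψ : LTL B} : IsGδ Φ → IsGδ Ψ → IsGδ (or Φ Ψ)
  | next {Φ : LTL B} : IsGδ Φ → IsGδ (next Φ)
  | wtil {Φ Ψ : LTL B} : IsGδ Φ → IsGδ Ψ → IsGδ (wtil Φ Ψ)

end LTL

/-- `○γ`: replace each atom `d` of `γ` by `⊥ · d`. -/
def Conj.next {B : Type u} : Conj (FinStream B) → Conj (FinStream B)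
  | .atom d => .atom d.shift
  | .tru => .tru
  | .and γ γ' => .and γ.next γ'.next

/-- `○φ`: replace each atom `d` of `φ` by `⊥ · d`. -/
def Geom.next {B : Type u} (φ : Geom (FinStream B)) : Geom (FinStream B) :=
  Geom.disj (Conj.next '' φ.disjuncts)

/-- The map `θ ↦ ψ ∨ (φ ∧ ○θ)` on geometric formulae, whose iterates approximate
`φ U ψ` (from `false`) and `φ W ψ` (from `true`). -/
def Geom.unfold {B : Type u} (φ ψ θ : Geom (FinStream B)) : Geom (FinStream B) :=
  ψ.or (φ.and θ.next)

namespace LTL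

variable {B : Type u}

/-- The geometric formula `F⟦Φ⟧` for `Φ` in `G`. (Only used for such `Φ`: the formula assigned to
the other formulae is irrelevant.) -/
def toGeom : LTL B → Geom (FinStream B)
  | atom a => Geom.ofConj (Conj.atom (FinStream.single a))
  | tru => Geom.tru
  | fls => Geom.fls
  | and Φ Ψ => Φ.toGeom.and Ψ.toGeom
  | or Φ Ψ => Φ.toGeom.or Ψ.toGeom
  | next Φ => Φ.toGeom.next
  | til Φ Ψ => Geom.iOr (fun n : ℕ => (Geom.unfold Φ.toGeom Ψ.toGeom)^[n] Geom.fls)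
  | neg _ => Geom.fls
  | wtil _ _ => Geom.fls

end LTL

/-- An antecedent-free theory `{ ⊢ φ | φ ∈ A }` is given by a set `A` of geometric formulae. -/
abbrev AFTheory (At : Type u) : Type u := Set (Geom At)

namespace AFTheory

/-- The set of sequents `true ⊢ φ` with `φ ∈ A`. -/
def toTheory {At : Type u} (A : AFTheory At) : Theory At := (fun φ => ⟨Geom.tru, φ⟩) '' A

/-- The theory `A ⋎ A' = { ⊢ φ ∨ φ' | φ ∈ A, φ' ∈ A' }`, with `Mod(A ⋎ A') = Mod(A) ∪ Mod(A')`. -/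
def or {At : Type u} (A A' : AFTheory At) : AFTheory At := Set.image2 Geom.or A A'

/-- The theory `⋎ᵢ Aᵢ = { ⊢ ⋁ᵢ φᵢ | φᵢ ∈ Aᵢ for all i }`, with `Mod(⋎ᵢ Aᵢ) = ⋃ᵢ Mod(Aᵢ)`. -/
def iOr {At : Type u} {ι : Type*} (A : ι → AFTheory At) : AFTheory At :=
  {χ | ∃ φ : ι → Geom At, (∀ i, φ i ∈ A i) ∧ χ = Geom.iOr φ}

/-- `○A = { ⊢ ○φ | φ ∈ A }`. -/
def next {B : Type u} (A : AFTheory (FinStream B)) : AFTheory (FinStream B) := Geom.next '' A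

/-- The map `C ↦ A' ⋎ (A ∪ ○C)` on antecedent-free theories. -/
def unfold {B : Type u} (A A' C : AFTheory (FinStream B)) : AFTheory (FinStream B) :=
  A'.or (A ∪ C.next)

end AFTheory

namespace LTL

variable {B : Type u}

open Classical in
/-- The antecedent-free theory translating a negation-free formula `Φ`: it is `{ ⊢ F⟦Φ⟧ }` for `Φ`
in `G`; otherwise conjunctions are translated to unions, disjunctions to `⋎`, and `U` and `W` as
the `⋎` (resp. the union) of the theories of their finite unfoldings. (Negated formulae have no
translation and get a dummy value.) -/
noncomputable def toAF : LTL B → AFTheory (FinStream B)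
  | atom a => {toGeom (atom a)}
  | tru => {toGeom tru}
  | fls => {toGeom fls}
  | and Φ Ψ => if (and Φ Ψ).IsG then {toGeom (and Φ Ψ)} else Φ.toAF ∪ Ψ.toAF
  | or Φ Ψ => if (or Φ Ψ).IsG then {toGeom (or Φ Ψ)} else Φ.toAF.or Ψ.toAF
  | next Φ => if (next Φ).IsG then {toGeom (next Φ)} else Φ.toAF.next
  | til Φ Ψ =>
      if (til Φ Ψ).IsG then {toGeom (til Φ Ψ)}
      else AFTheory.iOr (fun n : ℕ => (AFTheory.unfold Φ.toAF Ψ.toAF)^[n] {Geom.fls})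
  | wtil Φ Ψ =>
      if Φ.IsG ∧ Ψ.IsG then ⋃ n : ℕ, {(Geom.unfold Φ.toGeom Ψ.toGeom)^[n] Geom.tru}
      else ⋃ n : ℕ, (AFTheory.unfold Φ.toAF Ψ.toAF)^[n] {Geom.tru}
  | neg _ => ∅

/-- The geometric theory `T⟦Φ⟧` over `Fin(⟦Stream B⟧)`. -/
noncomputable def theory (Φ : LTL B) : Theory (FinStream B) := Φ.toAF.toTheory

end LTL

end StreamLogic

open StreamLogic

namespace StreamLogic

universe u

variable {At : Type u} {T : Theory At}

/-! # Soundness -/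

/-! Both conclusions rest on one model-existence statement, `exists_model_of_not_deriv`, proved by a
Henkin-style (Rasiowa–Sikorski, Baire category) construction. If `ψ` does not derive `φ`, some
disjunct `γ₀` of `ψ` does not. From `γ₀` one builds a descending sequence of conjunctive formulae,
none deriving `φ`: when the current formula derives the antecedent of a sequent of `T`,
distributivity lets it be conjoined with some disjunct of the consequent without making `φ`
derivable (`exists_strengthening`). Countability of `T` allows every sequent to be treated
infinitely often, so the atoms derivable along the sequence form a model of `T` satisfying `ψ` but
not `φ`.

Together with soundness this is completeness. Since satisfaction in a model respects
`T`-equivalence, each model is a point of the frame, which gives spatiality. The theories of `G_δ`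
formulae are countable by induction, whatever the size of `B`. -/

theorem Geom.sat_and {ν : At → Prop} {φ ψ : Geom At} :
    (φ.and ψ).Sat ν ↔ φ.Sat ν ∧ ψ.Sat ν := by
  constructor
  · rintro ⟨_, ⟨γ, hγ, γ', hγ', rfl⟩, h, h'⟩
    exact ⟨⟨γ, hγ, h⟩, ⟨γ', hγ', h'⟩⟩
  · rintro ⟨⟨γ, hγ, h⟩, ⟨γ', hγ', h'⟩⟩
    exact ⟨_, ⟨γ, hγ, γ', hγ', rfl⟩, h, h'⟩

theorem Geom.sat_iOr {ν : At → Prop} {ι : Type*} {φ : ι → Geom At} :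
    (Geom.iOr φ).Sat ν ↔ ∃ i, (φ i).Sat ν := by
  constructor
  · rintro ⟨γ, hγ, h⟩
    obtain ⟨i, hi⟩ := Set.mem_iUnion.1 hγ
    exact ⟨i, γ, hi, h⟩
  · rintro ⟨i, γ, hi, h⟩
    exact ⟨γ, Set.mem_iUnion.2 ⟨i, hi⟩, h⟩

theorem Geom.sat_tru (ν : At → Prop) : (Geom.tru : Geom At).Sat ν :=
  ⟨Conj.tru, rfl, trivial⟩

theorem Deriv.sound {ψ φ : Geom At} (h : Deriv T ψ φ) : Entails (Mod T) ψ φ := by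
  intro ν hν
  induction h with
  | th h => exact hν _ h
  | ax => exact id
  | cut _ _ h k => exact k ∘ h
  | andL₁ => exact fun h => (Geom.sat_and.1 h).1
  | andL₂ => exact fun h => (Geom.sat_and.1 h).2
  | andR _ _ h k => exact fun hθ => Geom.sat_and.2 ⟨h hθ, k hθ⟩
  | truR => exact fun _ => Geom.sat_tru ν
  | orL _ h =>
    intro hφ
    obtain ⟨i, hi⟩ := Geom.sat_iOr.1 hφ
    exact h i hi
  | orR φ i => exact fun h => Geom.sat_iOr.2 ⟨i, h⟩

/-! # Derivations between disjunctions of conjunctive formulae -/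

/-- This is a literal equality, not just an equivalence, so `Deriv.orL` and `Deriv.orR` apply to any
formula after rewriting. -/
theorem Geom.iOr_ofConj (φ : Geom At) :
    Geom.iOr (fun γ : φ.disjuncts => Geom.ofConj γ.1) = φ := by
  obtain ⟨S⟩ := φ
  simp [Geom.iOr, Geom.ofConj]

theorem Geom.and_ofConj (γ γ' : Conj At) :
    (Geom.ofConj γ).and (Geom.ofConj γ') = Geom.ofConj (γ.and γ') := by
  simp [Geom.and, Geom.ofConj]

theorem Deriv.of_mem {γ : Conj At} {φ : Geom At} (h : γ ∈ φ.disjuncts) :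
    Deriv T (Geom.ofConj γ) φ := by
  have := Deriv.orR (T := T) (fun γ : φ.disjuncts => Geom.ofConj γ.1) ⟨γ, h⟩
  rwa [Geom.iOr_ofConj] at this

theorem Deriv.of_forall_mem {ψ φ : Geom At}
    (h : ∀ γ ∈ ψ.disjuncts, Deriv T (Geom.ofConj γ) φ) : Deriv T ψ φ := by
  rw [← Geom.iOr_ofConj ψ]
  exact Deriv.orL fun γ => h γ.1 γ.2

theorem Deriv.and_ofConj_left (γ γ' : Conj At) :
    Deriv T (Geom.ofConj (γ.and γ')) (Geom.ofConj γ) := by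
  rw [← Geom.and_ofConj]
  exact Deriv.andL₁ _ _

theorem Deriv.and_ofConj_right (γ γ' : Conj At) :
    Deriv T (Geom.ofConj (γ.and γ')) (Geom.ofConj γ') := by
  rw [← Geom.and_ofConj]
  exact Deriv.andL₂ _ _

/-! # Completeness over countable theories -/

/-- A conjunctive formula not deriving `φ` can be strengthened so as to decide a given sequent
of the theory, while still not deriving `φ`. -/
theorem exists_strengthening {φ : Geom At} {γ : Conj At}
    (hγ : ¬ Deriv T (Geom.ofConj γ) φ) (s : Sequent At) :
    ∃ γ' : Conj At, ¬ Deriv T (Geom.ofConj γ') φ ∧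
      Deriv T (Geom.ofConj γ') (Geom.ofConj γ) ∧
      (s ∈ T → Deriv T (Geom.ofConj γ) s.lhs →
        ∃ δ ∈ s.rhs.disjuncts, Deriv T (Geom.ofConj γ') (Geom.ofConj δ)) := by
  by_cases hs : s ∈ T ∧ Deriv T (Geom.ofConj γ) s.lhs
  · obtain ⟨hsT, hl⟩ := hs
    by_contra! hcon
    -- `γ` derives `γ ∧ s.rhs`, whose disjuncts are the `γ ∧ δ`; if each of these derived `φ`, so
    -- would `γ`.
    refine hγ (Deriv.cut (Deriv.andR (Deriv.ax _) (hl.cut (Deriv.th hsT))) ?_)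
    refine Deriv.of_forall_mem ?_
    rintro _ ⟨_, rfl, δ, hδ, rfl⟩
    by_contra hd
    obtain ⟨-, -, h⟩ := hcon _ hd (Deriv.and_ofConj_left _ _)
    exact h δ hδ (Deriv.and_ofConj_right _ _)
  · exact ⟨γ, hγ, Deriv.ax _, fun h₁ h₂ => absurd ⟨h₁, h₂⟩ hs⟩

/-- The valuation determined by a sequence of conjunctive formulae: the atoms derivable from some
member of the sequence. -/
def limitValuation (T : Theory At) (g : ℕ → Conj At) : At → Prop :=
  fun p => ∃ n, Deriv T (Geom.ofConj (g n)) (Geom.ofConj (Conj.atom p))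

theorem deriv_of_le {g : ℕ → Conj At}
    (hg : ∀ n, Deriv T (Geom.ofConj (g (n + 1))) (Geom.ofConj (g n))) {m n : ℕ} (h : m ≤ n) :
    Deriv T (Geom.ofConj (g n)) (Geom.ofConj (g m)) := by
  induction h with
  | refl => exact Deriv.ax _
  | step _ ih => exact (hg _).cut ih

/-- The sequence descends, so the formulae derivable from some member form a filter: two conjuncts
derived at different stages are both derived at the later one. -/
theorem sat_limitValuation {g : ℕ → Conj At}
    (hg : ∀ n, Deriv T (Geom.ofConj (g (n + 1))) (Geom.ofConj (g n))) (γ : Conj At) :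
    γ.Sat (limitValuation T g) ↔ ∃ n, Deriv T (Geom.ofConj (g n)) (Geom.ofConj γ) := by
  induction γ with
  | atom p => exact Iff.rfl
  | tru => exact ⟨fun _ => ⟨0, Deriv.truR _⟩, fun _ => trivial⟩
  | and γ γ' ih ih' =>
    constructor
    · rintro ⟨h, h'⟩
      obtain ⟨n, hn⟩ := ih.1 h
      obtain ⟨m, hm⟩ := ih'.1 h'
      refine ⟨max n m, ?_⟩
      rw [← Geom.and_ofConj]
      exact Deriv.andR ((deriv_of_le hg (le_max_left n m)).cut hn)
        ((deriv_of_le hg (le_max_right n m)).cut hm)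
    · rintro ⟨n, hn⟩
      exact ⟨ih.2 ⟨n, hn.cut (Deriv.and_ofConj_left _ _)⟩,
        ih'.2 ⟨n, hn.cut (Deriv.and_ofConj_right _ _)⟩⟩

theorem exists_model_of_not_deriv (hT : T.Countable) {ψ φ : Geom At} (h : ¬ Deriv T ψ φ) :
    ∃ ν ∈ Mod T, ψ.Sat ν ∧ ¬ φ.Sat ν := by
  have hex : ∃ γ ∈ ψ.disjuncts, ¬ Deriv T (Geom.ofConj γ) φ := by
    by_contra! hcon
    exact h (Deriv.of_forall_mem hcon)
  obtain ⟨γ₀, hγ₀, hγ₀φ⟩ := hex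
  have : Nonempty (Sequent At) := ⟨⟨Geom.tru, Geom.tru⟩⟩
  -- The range of `f` only has to contain `T`, which may be empty; sequents outside `T` impose
  -- nothing in `exists_strengthening`.
  obtain ⟨f, hf⟩ := Set.countable_iff_exists_subset_range.1 hT
  -- Stage `n` treats the sequent numbered by the first component of `n.unpair`, so each sequent
  -- recurs at arbitrarily late stages.
  choose step hφ hle hstep using
    fun (n : ℕ) (γ : {γ : Conj At // ¬ Deriv T (Geom.ofConj γ) φ}) =>
      exists_strengthening γ.2 (f n.unpair.1)
  let c : ℕ → {γ : Conj At // ¬ Deriv T (Geom.ofConj γ) φ} :=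
    Nat.rec ⟨γ₀, hγ₀φ⟩ fun n γ => ⟨step n γ, hφ n γ⟩
  let g : ℕ → Conj At := fun n => (c n).1
  have hg : ∀ n, Deriv T (Geom.ofConj (g (n + 1))) (Geom.ofConj (g n)) := fun n => hle n (c n)
  refine ⟨limitValuation T g, ?_, ⟨γ₀, hγ₀, (sat_limitValuation hg γ₀).2 ⟨0, Deriv.ax _⟩⟩, ?_⟩
  · rintro s hs ⟨γ, hγ, hsat⟩
    obtain ⟨n, hn⟩ := (sat_limitValuation hg γ).1 hsat
    obtain ⟨k, rfl⟩ := hf hs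
    -- Stage `Nat.pair k n` treats the sequent `f k` and comes no earlier than `n`, so the
    -- antecedent is already derivable there.
    have hm : Deriv T (Geom.ofConj (g (Nat.pair k n))) (f k).lhs :=
      (deriv_of_le hg (Nat.right_le_pair k n)).cut (hn.cut (Deriv.of_mem hγ))
    have key := hstep (Nat.pair k n) (c (Nat.pair k n))
    rw [Nat.unpair_pair] at key
    obtain ⟨δ, hδ, hd⟩ := key hs hm
    exact ⟨δ, hδ, (sat_limitValuation hg δ).2 ⟨Nat.pair k n + 1, hd⟩⟩
  · rintro ⟨γ, hγ, hsat⟩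
    obtain ⟨n, hn⟩ := (sat_limitValuation hg γ).1 hsat
    exact (c n).2 (hn.cut (Deriv.of_mem hγ))

theorem deductionComplete_of_countable (hT : T.Countable) : DeductionComplete T := by
  refine fun ψ φ => ⟨Deriv.sound, fun h => ?_⟩
  by_contra hd
  obtain ⟨ν, hν, hψ, hφ⟩ := exists_model_of_not_deriv hT hd
  exact hφ (h ν hν hψ)

/-! # Points from models -/

/-- Satisfaction in a model of `T`, as a predicate on `T`-equivalence classes. -/
def GeomQuot.Sat {ν : At → Prop} (hν : ν ∈ Mod T) : GeomQuot T → Prop :=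
  Quotient.lift (Geom.Sat ν) fun _ _ h => propext ⟨h.1.sound ν hν, h.2.sound ν hν⟩

theorem GeomQuot.mk_tru : GeomQuot.mk T Geom.tru = ⊤ := by
  refine top_le_iff.1 ?_
  obtain ⟨φ, hφ⟩ := GeomQuot.mk_surjective (⊤ : GeomQuot T)
  rw [← hφ]
  exact Deriv.truR φ

/-- The point of `Geom(At)/T` given by a model of `T`. -/
def pointOfModel {ν : At → Prop} (hν : ν ∈ Mod T) : FrameHom (GeomQuot T) Prop where
  toFun := GeomQuot.Sat hν
  map_inf' := by
    intro a b
    obtain ⟨φ, rfl⟩ := GeomQuot.mk_surjective a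
    obtain ⟨ψ, rfl⟩ := GeomQuot.mk_surjective b
    rw [GeomQuot.mk_inf_mk]
    exact propext Geom.sat_and
  map_top' := by
    rw [← GeomQuot.mk_tru]
    exact eq_true (Geom.sat_tru ν)
  map_sSup' := by
    intro s
    rw [sSup_image, iSup_Prop_eq]
    refine propext (Geom.sat_iOr.trans ?_)
    constructor
    · rintro ⟨⟨φ, hφ⟩, h⟩
      exact ⟨GeomQuot.mk T φ, iSup_Prop_eq ▸ ⟨hφ, h⟩⟩
    · rintro ⟨a, ha⟩
      obtain ⟨φ, rfl⟩ := GeomQuot.mk_surjective a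
      obtain ⟨hφ, h⟩ := iSup_Prop_eq ▸ ha
      exact ⟨⟨φ, hφ⟩, h⟩

theorem isSpatial_of_countable (hT : T.Countable) : IsSpatial (GeomQuot T) := by
  intro a b hab
  obtain ⟨ψ, rfl⟩ := GeomQuot.mk_surjective a
  obtain ⟨φ, rfl⟩ := GeomQuot.mk_surjective b
  obtain ⟨ν, hν, hψ, hφ⟩ := exists_model_of_not_deriv hT hab
  exact ⟨pointOfModel hν, hψ, hφ⟩

/-! # Countability of the theories of `G_δ` formulae -/

theorem AFTheory.countable_iterate_unfold {B : Type u} {A A' C : AFTheory (FinStream B)}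
    (hA : A.Countable) (hA' : A'.Countable) (hC : C.Countable) (n : ℕ) :
    ((AFTheory.unfold A A')^[n] C).Countable := by
  induction n with
  | zero => exact hC
  | succ n ih =>
    rw [Function.iterate_succ_apply']
    exact hA'.image2 (hA.union (ih.image _)) _

theorem LTL.IsG.countable_toAF {B : Type u} {Φ : LTL B} (h : Φ.IsG) : Φ.toAF.Countable := by
  cases Φ with
  | atom | tru | fls => exact Set.countable_singleton _
  | neg | wtil => exact h.elim
  | _ =>
    rw [LTL.toAF, if_pos h]
    exact Set.countable_singleton _

/-- Unions, images and binary `⋎` preserve countability. The infinitary `⋎` of the `U` clause,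
ranging over all choice sequences, never occurs: in a `G_δ` formula, `U` appears only inside `G`
subformulae, whose theories are singletons. -/
theorem LTL.IsGδ.countable_toAF {B : Type u} {Φ : LTL B} (h : Φ.IsGδ) : Φ.toAF.Countable := by
  induction h with
  | ofG h => exact h.countable_toAF
  | and _ _ h k =>
    rw [LTL.toAF]
    split_ifs
    exacts [Set.countable_singleton _, h.union k]
  | or _ _ h k =>
    rw [LTL.toAF]
    split_ifs
    exacts [Set.countable_singleton _, h.image2 k _]
  | next _ h =>
    rw [LTL.toAF]
    split_ifs
    exacts [Set.countable_singleton _, h.image _]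
  | wtil _ _ h k =>
    rw [LTL.toAF]
    split_ifs
    · exact Set.countable_iUnion fun _ => Set.countable_singleton _
    · exact Set.countable_iUnion
        (AFTheory.countable_iterate_unfold h k (Set.countable_singleton _))

end StreamLogic

open StreamLogic
theorem mainTheorem8 :
    (∀ {At : Type*} (T : Theory At), T.Countable →
      IsSpatial (GeomQuot T) ∧ DeductionComplete T) ∧
    (∀ {B : Type*} (Φ : LTL B), Φ.IsGδ →
      IsSpatial (GeomQuot Φ.theory) ∧ DeductionComplete Φ.theory) := by
  refine ⟨fun T hT => ⟨isSpatial_of_countable hT, deductionComplete_of_countable hT⟩,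
    fun Φ h => ?_⟩
  have hT : Φ.theory.Countable := h.countable_toAF.image _
  exact ⟨isSpatial_of_countable hT, deductionComplete_of_countable hT⟩
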